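/- Let $A$ be a finite alphabet, $D$ a nonempty prediction space and $l:A\times D\to[0,l_{\max}]$ a loss function with $l_{\max}<\infty$. Assume that $D$ is finite, or that $D$ is a bounded metric space and $l(a,\cdot)$ is Lipschitz, with a constant not depending on $a\in A$. Let $V_n=\{0,\dots,n-1\}^2$. A *scandictor* for a finite set $B\subset\mathbb{Z}^2$ is a pair $(\Psi,F)$ of sequences of maps $\Psi_t:A^{t-1}\to B$ and $F_t:A^{t-1}\to D$, $1\le t\le|B|$, where $\Psi_t$ gives the site visited at time $t$ and $F_t$ the prediction of its value, as functions of the values $x_{\Psi_1},\dots,x_{\Psi_{t-1}}$ observed before, such that for every $x\in A^B$ the visited sites $\Psi_1,\dots,\Psi_{|B|}$ exhaust $B$. Its cumulative loss is $L_{(\Psi,F)}(x_B)=\sum_{t=1}^{|B|}l\big(x_{\Psi_t},F_t(x_{\Psi_1},\dots,x_{\Psi_{t-1}})\big)$. It works *block-wise with block size $m$* if, for every $x$, the sites of $B$ in each cell of the partition of $\mathbb{Z}^2$ into the $m\times m$ squares $\{im,\dots,im+m-1\}\times\{jm,\dots,jm+m-1\}$ are visited consecutively in time. For a probability measure $Q$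 on $A^{\mathbb{Z}^2}$, the law of a random field $X$, put $U(l,Q_B)=\inf_{(\Psi,F)}E_Q\frac1{|B|}L_{(\Psi,F)}(X_B)$, the infimum being over all scandictors for $B$. The *scandictability* of $Q$ is $U(l,Q)=\lim_{n\to\infty}U(l,Q_{V_n})$. The measure $Q$ is *stationary* if it is invariant under all translations of $\mathbb{Z}^2$, and *strongly mixing* if for all $a,b\in\mathbb{N}\cup\{\infty\}$, as $k\to\infty$, the supremum of $|Q(G\cap H)-Q(G)Q(H)|$ over all $G\in\sigma(X_S)$, $H\in\sigma(X_T)$ and all $S,T\subset\mathbb{Z}^2$ with $|S|\le a$, $|T|\le b$ and $\ell^1$-distance at least $k$ tends to $0$. Then there are, for every block size $m\ge1$, scandictors $(\Psi,F)_{m,n}$ for $V_n$, $n\ge1$, that work block-wise with block size $m$ and do not depend on $Q$, such that for every stationary strongly mixing probability measure $Q$ on $A^{\mathbb{Z}^2}$ the limit defining $U(l,Q)$ exists, and there is a sequence $\delta(m)$ (which may depend on $Q$) with $\delta(m)\to0$ as $m\to\infty$ and, for every $m\ge1$, $$\liminf_{n\to\infty}\frac1{|V_n|}L_{(\Psi,F)_{m,n}}(X_{V_n})\le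 U(l,Q)+\delta(m)\qquad Q\text{-a.s.}$$ Moreover, as $m\to\infty$ the performance equals the scandictability of the source: $$\lim_{m\to\infty}\,\liminf_{n\to\infty}\frac1{|V_n|}L_{(\Psi,F)_{m,n}}(X_{V_n})=U(l,Q)\qquad Q\text{-a.s.}$$ -/

import Mathlib

namespace Scandiction

/-- The square `V_n = {0, …, n-1} × {0, …, n-1}` of sites. -/
noncomputable def square (n : ℕ) : Finset (ℤ × ℤ) :=
  Finset.Ico (0 : ℤ) n ×ˢ Finset.Ico (0 : ℤ) n

section Path

variable {A : Type*}

/-- The values observed during the first `t` steps when the data array `x` is scanned by the rule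
`site`, which maps the list of the values observed so far to the next site to be visited. -/
def observed (site : List A → ℤ × ℤ) (x : ℤ × ℤ → A) : ℕ → List A
  | 0 => []
  | t + 1 => observed site x t ++ [x (site (observed site x t))]

/-- The site visited in step `t` (steps are numbered from `0`). -/
def visited (site : List A → ℤ × ℤ) (x : ℤ × ℤ → A) (t : ℕ) : ℤ × ℤ :=
  site (observed site x t)

end Path

/-- A (deterministic) scandictor for the finite set of sites `B`, with data alphabet `A` and
prediction space `D`: a scanning rule and a prediction rule, both functions of the values observed
so far, such that every array is scanned completely in `|B|` steps. The maps `A^{t-1} → B` and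
`A^{t-1} → D`, `1 ≤ t ≤ |B|`, are the restrictions of `site` and `pred` to the lists of length
`t - 1`; values on longer lists play no role. For a finite alphabet all such maps are measurable. -/
structure Scandictor (A D : Type*) (B : Finset (ℤ × ℤ)) where
  /-- the next site, as a function of the values observed so far -/
  site : List A → ℤ × ℤ
  /-- the prediction for the value at the next site, as a function of the values observed so far -/
  pred : List A → D
  /-- for every array, the sites visited in the first `|B|` steps are exactly those of `B` -/
  covers : ∀ x : ℤ × ℤ → A, (Finset.range B.card).image (visited site x) = B

section Loss

variable {A D : Type*} {B : Finset (ℤ × ℤ)}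

/-- The cumulative loss of a scandictor for `B` on the array `x`. It depends only on the restriction
of `x` to `B`. -/
def Scandictor.loss (S : Scandictor A D B) (l : A → D → ℝ) (x : ℤ × ℤ → A) : ℝ :=
  ∑ t ∈ Finset.range B.card, l (x (visited S.site x t)) (S.pred (observed S.site x t))

/-- The cumulative loss divided by the number of sites. -/
noncomputable def Scandictor.normalizedLoss (S : Scandictor A D B) (l : A → D → ℝ)
    (x : ℤ × ℤ → A) : ℝ :=
  S.loss l x / (B.card : ℝ)

/-- The index of the cell of the `m × m` grid that contains a site. -/
def blockIndex (m : ℕ) (i : ℤ × ℤ) : ℤ × ℤ :=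
  (i.1 / (m : ℤ), i.2 / (m : ℤ))

/-- The scandictor works block by block, with blocks of size `m × m` (truncated at the boundary of
`B`): the visits to the sites of one block are consecutive in time. -/
def Scandictor.IsBlockwise (S : Scandictor A D B) (m : ℕ) : Prop :=
  ∀ (x : ℤ × ℤ → A) (s t u : ℕ), s < t → t < u → u < B.card →
    blockIndex m (visited S.site x s) = blockIndex m (visited S.site x u) →
    blockIndex m (visited S.site x t) = blockIndex m (visited S.site x s)

end Loss

section Field

variable {A D : Type*} [MeasurableSpace A]

open MeasureTheory

/-- The law `Q` of a random field on `ℤ²` is invariant under all translations. -/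
def IsStationary (Q : Measure (ℤ × ℤ → A)) : Prop :=
  ∀ i : ℤ × ℤ, Q.map (fun x j => x (j + i)) = Q

/-- The σ-algebra generated by the restriction of the field to the set of sites `S`. -/
abbrev sigmaOn (A : Type*) [MeasurableSpace A] (S : Set (ℤ × ℤ)) : MeasurableSpace (ℤ × ℤ → A) :=
  MeasurableSpace.comap (fun x (i : S) => x i) inferInstance

/-- The dependence coefficient `α(S, T)` of the restrictions of the field to `S` and to `T`. -/
noncomputable def alpha (Q : Measure (ℤ × ℤ → A)) (S T : Set (ℤ × ℤ)) : ℝ :=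
  sSup {r | ∃ U V : Set (ℤ × ℤ → A), MeasurableSet[sigmaOn A S] U ∧ MeasurableSet[sigmaOn A T] V ∧
    r = |Q.real (U ∩ V) - Q.real U * Q.real V|}

/-- The strong mixing coefficient `α_{a,b}(k)`: the supremum of `α(S, T)` over `|S| ≤ a`, `|T| ≤ b`
whose `ℓ¹`-distance is at least `k`. -/
noncomputable def mixingCoeff (Q : Measure (ℤ × ℤ → A)) (a b : ℕ∞) (k : ℕ) : ℝ :=
  sSup {r | ∃ S T : Set (ℤ × ℤ), S.encard ≤ a ∧ T.encard ≤ b ∧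
    (∀ i ∈ S, ∀ j ∈ T, (k : ℤ) ≤ |i.1 - j.1| + |i.2 - j.2|) ∧ r = alpha Q S T}

/-- `Q` is strongly mixing: `α_{a,b}(k) → 0` as `k → ∞` for all `a, b ∈ ℕ ∪ {∞}`. -/
def IsStronglyMixing (Q : Measure (ℤ × ℤ → A)) : Prop :=
  ∀ a b : ℕ∞, Filter.Tendsto (mixingCoeff Q a b) Filter.atTop (nhds 0)

/-- The scandictability `U(l, Q_B)` of `Q` on the finite set of sites `B`: the least expected
normalized cumulative loss of a scandictor for `B`. -/
noncomputable def scandictabilityOn (l : A → D → ℝ) (Q : Measure (ℤ × ℤ → A))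
    (B : Finset (ℤ × ℤ)) : ℝ :=
  ⨅ S : Scandictor A D B, ∫ x, S.normalizedLoss l x ∂Q

/-- The scandictability `U(l, Q)`: the limit of `U(l, Q_{V_n})` as `n → ∞`. -/
noncomputable def scandictability (l : A → D → ℝ) (Q : Measure (ℤ × ℤ → A)) : ℝ :=
  Filter.limUnder Filter.atTop (fun n : ℕ => scandictabilityOn l Q (square n))

end Field

end Scandiction

/-!
For a fixed block size `m`, the losses of the scandictors for one `m × m` block form a bounded family
of functions on the finite set of block contents, so finitely many block rules `E j` approximate all
of them uniformly up to `1 / m` (`exists_finite_net`). Some rule in this finite family therefore has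
expected normalized loss `e m` with `U(V_m) ≤ e m ≤ U(V_m) + 1 / m`.

Which rule is best depends on the law `Q` and has to be learned. The scandictor for `V_n` explores a
square of about `√(n / m)` by `√(n / m)` blocks with an arbitrary rule. Afterwards all data of that
region are known, hence also the loss that each rule would have had there; the rule with the
least such loss is applied to every other block (`exists_universal_scandictor`, built by running
scandictors for disjoint sets one after the other, `Scandictor.append`). The region itself and the
truncated blocks are a vanishing share of `V_n`.

If `Q` is stationary and strongly mixing, every nontrivial translation is ergodic
(`IsStronglyMixing.ergodic_shift`), and a pointwise ergodic theorem for squares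
(`ae_tendsto_squareAverage`, two applications of Birkhoff's theorem) shows that the average loss of
each rule converges almost surely to its expectation. It does so both on the training region and on
all of `V_n`, so the selected rule is asymptotically optimal and the normalized loss
converges almost surely to `e m` (`exists_universal_sequence`).

By dominated convergence `limsup U(V_n) ≤ e m ≤ U(V_m) + 1 / m` for every `m`, so `U(V_n)` converges to
a limit `U`, and `e m → U`. Thus `δ m = e m - U` has the required properties, and the
performance for block size `m`, which is almost surely equal to `e m`, tends to `U`.
-/

namespace Scandiction

open MeasureTheory Filter Topology

/-! ### Birkhoff's theorem and averages over squares -/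

section Ergodic

variable {Ω : Type*}

/-- The running maximum `max_{0 ≤ k ≤ n} S_k` of the Birkhoff sums of `g` along `T`, written through
the recursion it satisfies. -/
def maxBirkhoff (T : Ω → Ω) (g : Ω → ℝ) : ℕ → Ω → ℝ
  | 0 => fun _ => 0
  | n + 1 => fun x => max 0 (g x + maxBirkhoff T g n (T x))

variable {T : Ω → Ω} {g : Ω → ℝ}

lemma maxBirkhoff_nonneg (n : ℕ) (x : Ω) : 0 ≤ maxBirkhoff T g n x := by
  cases n with
  | zero => exact le_rfl
  | succ n => exact le_max_left _ _

lemma birkhoffSum_le_maxBirkhoff (n : ℕ) (x : Ω) :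
    birkhoffSum T g n x ≤ maxBirkhoff T g n x := by
  induction n generalizing x with
  | zero => simp [maxBirkhoff]
  | succ n ih =>
    rw [birkhoffSum_succ']
    exact le_max_of_le_right (by linarith [ih (T x)])

lemma maxBirkhoff_le_succ (n : ℕ) (x : Ω) :
    maxBirkhoff T g n x ≤ maxBirkhoff T g (n + 1) x := by
  induction n generalizing x with
  | zero => exact maxBirkhoff_nonneg 1 x
  | succ n ih => exact max_le_max le_rfl (by linarith [ih (T x)])

lemma monotone_maxBirkhoff (x : Ω) : Monotone fun n => maxBirkhoff T g n x :=
  monotone_nat_of_le_succ fun n => maxBirkhoff_le_succ n x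

lemma maxBirkhoff_succ_sub (n : ℕ) (x : Ω) :
    maxBirkhoff T g (n + 1) x - maxBirkhoff T g n (T x) = max (-maxBirkhoff T g n (T x)) (g x) := by
  change max 0 (g x + _) - _ = _
  rw [sub_eq_add_neg, max_add]; simp

/-- The average of `g` along the square `{0, …, n-1}²` of an action by two maps `T₁`, `T₂`. -/
noncomputable def squareAverage (T₁ T₂ : Ω → Ω) (g : Ω → ℝ) (n : ℕ) (x : Ω) : ℝ :=
  birkhoffAverage ℝ T₁ (fun y => birkhoffAverage ℝ T₂ g n y) n x

lemma birkhoffAverage_mono {f h : Ω → ℝ} (hfh : ∀ x, f x ≤ h x) (n : ℕ) (x : Ω) :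
    birkhoffAverage ℝ T f n x ≤ birkhoffAverage ℝ T h n x := by
  simp only [birkhoffAverage, smul_eq_mul, birkhoffSum]
  gcongr
  exact hfh _

lemma birkhoffAverage_const {n : ℕ} (hn : 0 < n) (c : ℝ) (x : Ω) :
    birkhoffAverage ℝ T (fun _ => c) n x = c := by
  have : (n : ℝ) ≠ 0 := by positivity
  simp [birkhoffAverage, birkhoffSum, this]

lemma abs_birkhoffAverage_sub_le {c : ℝ} {n : ℕ} (hn : 0 < n) {f h : Ω → ℝ}
    (hfh : ∀ x, |f x - c| ≤ h x) (x : Ω) :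
    |birkhoffAverage ℝ T f n x - c| ≤ birkhoffAverage ℝ T h n x := by
  have h1 := birkhoffAverage_mono (T := T) (fun x => (abs_le.mp (hfh x)).1) n x
  have h2 := birkhoffAverage_mono (T := T) (fun x => (abs_le.mp (hfh x)).2) n x
  have h3 : birkhoffAverage ℝ T (fun x => f x - c) n x = birkhoffAverage ℝ T f n x - c := by
    have hn' : (n : ℝ) ≠ 0 := by positivity
    simp [birkhoffAverage, birkhoffSum, Finset.sum_sub_distrib, mul_sub, hn']
  have h4 : birkhoffAverage ℝ T (fun x => -h x) n x = -birkhoffAverage ℝ T h n x := by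
    simp [birkhoffAverage, birkhoffSum]
  rw [abs_le]
  constructor <;> linarith

variable [MeasurableSpace Ω] {μ : Measure Ω}

lemma measurable_maxBirkhoff (hT : Measurable T) (hg : Measurable g) (n : ℕ) :
    Measurable (maxBirkhoff T g n) := by
  induction n with
  | zero => exact measurable_const
  | succ n ih => exact measurable_const.max (hg.add (ih.comp hT))

lemma integrable_maxBirkhoff (hT : MeasurePreserving T μ μ) (hgi : Integrable g μ)
    (n : ℕ) : Integrable (maxBirkhoff T g n) μ := by
  induction n with
  | zero => exact integrable_zero Ω ℝ μ
  | succ n ih =>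
    exact (integrable_zero Ω ℝ μ).sup (hgi.add (hT.integrable_comp_of_integrable ih))

lemma integral_comp_of_measurePreserving (hT : MeasurePreserving T μ μ) {f : Ω → ℝ}
    (hf : Measurable f) : ∫ x, f (T x) ∂μ = ∫ x, f x ∂μ := by
  conv_rhs => rw [← hT.map_eq]
  exact (integral_map hT.aemeasurable hf.aestronglyMeasurable).symm

/-- A maximal ergodic theorem: if `∫ g < 0`, the Birkhoff sums of `g` are almost surely bounded
above. The set where they are not is invariant, hence null or of full measure; were it of full
measure, the nonnegative numbers `∫ (M_{n+1} - M_n) = ∫ max (-M_n ∘ T) g` would converge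
to `∫ g`. -/
lemma ae_bddAbove_birkhoffSum (hT : Ergodic T μ) (hg : Measurable g) (hgi : Integrable g μ)
    (hneg : ∫ x, g x ∂μ < 0) : ∀ᵐ x ∂μ, ∃ C : ℝ, ∀ n, birkhoffSum T g n x ≤ C := by
  set M := maxBirkhoff T g with hM
  have hTp := hT.toMeasurePreserving
  have hMm : ∀ n, Measurable (M n) := measurable_maxBirkhoff hTp.measurable hg
  have hMi : ∀ n, Integrable (M n) μ := integrable_maxBirkhoff hTp hgi
  set E : Set Ω := {x | Tendsto (fun n => M n x) atTop atTop} with hE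
  have hEm : MeasurableSet E := by
    have : E = ⋂ C : ℕ, ⋃ n, {x | (C : ℝ) ≤ M n x} := by
      ext x
      simp only [hE, Set.mem_ofPred_eq, Set.mem_iInter, Set.mem_iUnion]
      refine ⟨fun h C => (h.eventually_ge_atTop (C : ℝ)).exists, fun h => ?_⟩
      refine tendsto_atTop_atTop_of_monotone (monotone_maxBirkhoff x) fun b => ?_
      obtain ⟨C, hC⟩ := exists_nat_ge b
      obtain ⟨n, hn⟩ := h C
      exact ⟨n, hC.trans hn⟩
    rw [this]
    exact MeasurableSet.iInter fun C => MeasurableSet.iUnion fun n =>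
      measurableSet_le measurable_const (hMm n)
  have hEinv : T ⁻¹' E = E := by
    ext x
    have hstep : ∀ n, M (n + 1) x = max 0 (g x + M n (T x)) := fun n => rfl
    simp only [hE, Set.mem_preimage, Set.mem_ofPred_eq]
    rw [← tendsto_add_atTop_iff_nat (f := fun n => M n x) 1]
    constructor
    · intro h
      refine tendsto_atTop_mono (fun n => le_max_right _ _) (tendsto_atTop_add_const_left _ (g x) h)
    · intro h
      refine tendsto_atTop_mono' _ ?_ (tendsto_atTop_add_const_left _ (-g x) h)
      filter_upwards [h.eventually_gt_atTop 0] with n hn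
      rw [hstep] at hn ⊢
      rcases max_cases 0 (g x + M n (T x)) with h' | h' <;> linarith
  rcases hT.toPreErgodic.ae_mem_or_ae_notMem hEm hEinv with hfull | hnull
  · exfalso
    have hlim : Tendsto (fun n => ∫ x, max (-M n (T x)) (g x) ∂μ) atTop (𝓝 (∫ x, g x ∂μ)) := by
      refine tendsto_integral_of_dominated_convergence (fun x => |g x|) (fun n => ?_) hgi.abs
        (fun n => ?_) ?_
      · exact (((hMm n).comp hTp.measurable).neg.max hg).aestronglyMeasurable
      · filter_upwards with x
        have := maxBirkhoff_nonneg (T := T) (g := g) n (T x)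
        rw [Real.norm_eq_abs, abs_le]
        refine ⟨(neg_abs_le _).trans (le_max_right _ _), max_le ?_ (le_abs_self _)⟩
        exact (neg_nonpos.mpr this).trans (abs_nonneg _)
      · filter_upwards [hfull] with x hx
        have hx' : Tendsto (fun n => M n (T x)) atTop atTop := by
          have : x ∈ T ⁻¹' E := by rw [hEinv]; exact hx
          exact this
        refine tendsto_const_nhds.congr' ?_
        filter_upwards [hx'.eventually_ge_atTop (-g x)] with n hn
        rw [max_eq_right (by linarith)]
    have hnn : ∀ n, 0 ≤ ∫ x, max (-M n (T x)) (g x) ∂μ := by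
      intro n
      have h1 : ∫ x, max (-M n (T x)) (g x) ∂μ = ∫ x, (M (n + 1) x - M n (T x)) ∂μ :=
        integral_congr_ae (Eventually.of_forall fun x => (maxBirkhoff_succ_sub n x).symm)
      rw [h1, integral_sub (g := fun x => M n (T x)) (hMi _) (hTp.integrable_comp_of_integrable (hMi n)),
       
        integral_comp_of_measurePreserving hTp (hMm n), sub_nonneg]
      exact integral_mono (hMi _) (hMi _) (maxBirkhoff_le_succ n)
    exact absurd (ge_of_tendsto' hlim hnn) (not_le.mpr hneg)
  · filter_upwards [hnull] with x hx
    rcases tendsto_atTop_of_monotone (monotone_maxBirkhoff (T := T) (g := g) x) with h | ⟨C, hC⟩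
    · exact absurd h hx
    · exact ⟨C, fun n => (birkhoffSum_le_maxBirkhoff n x).trans
        ((monotone_maxBirkhoff x).ge_of_tendsto hC n)⟩

lemma measurable_birkhoffAverage (hT : Measurable T) (hg : Measurable g) (n : ℕ) :
    Measurable fun x => birkhoffAverage ℝ T g n x := by
  simp only [birkhoffAverage, birkhoffSum]
  exact (Finset.measurable_sum _ fun k _ => hg.comp (hT.iterate k)).const_mul (n : ℝ)⁻¹

variable [IsProbabilityMeasure μ]

lemma ae_eventually_birkhoffAverage_lt (hT : Ergodic T μ) (hg : Measurable g)
    (hgi : Integrable g μ) {a : ℝ} (ha : ∫ x, g x ∂μ < a) :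
    ∀ᵐ x ∂μ, ∀ᶠ n in atTop, birkhoffAverage ℝ T g n x < a := by
  obtain ⟨b, hb, hba⟩ := exists_between ha
  have hint : ∫ x, (g x - b) ∂μ < 0 := by
    rw [integral_sub hgi (integrable_const b)]
    simpa using hb
  filter_upwards [ae_bddAbove_birkhoffSum hT (hg.sub_const b) (hgi.sub (integrable_const b)) hint]
    with x ⟨C, hC⟩
  have hlim : Tendsto (fun n : ℕ => b + C / n) atTop (𝓝 (b + 0)) :=
    tendsto_const_nhds.add (tendsto_const_div_atTop_nhds_zero_nat C)
  rw [add_zero] at hlim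
  filter_upwards [hlim.eventually_lt_const hba, eventually_gt_atTop 0] with n hn hn0
  refine lt_of_le_of_lt ?_ hn
  have hn0' : (0 : ℝ) < n := by exact_mod_cast hn0
  have h1 : birkhoffSum T (fun x => g x - b) n x = birkhoffSum T g n x - n * b := by
    simp [birkhoffSum, Finset.sum_sub_distrib]
  have h2 := hC n
  rw [h1] at h2
  rw [birkhoffAverage, smul_eq_mul, inv_mul_le_iff₀ hn0', mul_add, mul_div_cancel₀ _ hn0'.ne']
  linarith

/-- Birkhoff's pointwise ergodic theorem for an ergodic map. -/
theorem ae_tendsto_birkhoffAverage (hT : Ergodic T μ) (hg : Measurable g)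
    (hgi : Integrable g μ) :
    ∀ᵐ x ∂μ, Tendsto (fun n => birkhoffAverage ℝ T g n x) atTop (𝓝 (∫ x, g x ∂μ)) := by
  have hup : ∀ k : ℕ, ∀ᵐ x ∂μ, ∀ᶠ n in atTop,
      birkhoffAverage ℝ T g n x < ∫ x, g x ∂μ + 1 / ((k : ℝ) + 1) := fun k =>
    ae_eventually_birkhoffAverage_lt hT hg hgi (by linarith [Nat.one_div_pos_of_nat (α := ℝ) (n := k)])
  have hlow : ∀ k : ℕ, ∀ᵐ x ∂μ, ∀ᶠ n in atTop,
      birkhoffAverage ℝ T (-g) n x < -∫ x, g x ∂μ + 1 / ((k : ℝ) + 1) := fun k =>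
    ae_eventually_birkhoffAverage_lt hT hg.neg hgi.neg (by
      rw [show ∫ x, (-g) x ∂μ = -∫ x, g x ∂μ from integral_neg g]
      linarith [Nat.one_div_pos_of_nat (α := ℝ) (n := k)])
  filter_upwards [ae_all_iff.mpr hup, ae_all_iff.mpr hlow] with x hx hx'
  rw [Metric.tendsto_nhds]
  intro ε hε
  obtain ⟨k, hk⟩ := exists_nat_one_div_lt hε
  filter_upwards [hx k, hx' k] with n h1 h2
  rw [birkhoffAverage_neg, Pi.neg_apply, Pi.neg_apply] at h2
  rw [Real.dist_eq, abs_lt]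
  constructor <;> linarith

/-- A pointwise ergodic theorem for averages over growing squares: for a bounded function, Birkhoff's
theorem for `T₂` is applied first, and the remaining error is dominated by
`sup_{k ≥ N} |A_k g - ∫ g|`, to which Birkhoff's theorem for `T₁` applies. -/
theorem ae_tendsto_squareAverage {T₁ T₂ : Ω → Ω} (hT₁ : Ergodic T₁ μ) (hT₂ : Ergodic T₂ μ)
    (hg : Measurable g) {C : ℝ} (hC : ∀ x, |g x| ≤ C) :
    ∀ᵐ x ∂μ, Tendsto (fun n => squareAverage T₁ T₂ g n x) atTop (𝓝 (∫ x, g x ∂μ)) := by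
  set c := ∫ x, g x ∂μ with hc
  have hgi : Integrable g μ :=
    Integrable.of_bound hg.aestronglyMeasurable C (Eventually.of_forall hC)
  set h : ℕ → Ω → ℝ := fun n x => |birkhoffAverage ℝ T₂ g n x - c| with hh
  have hhm : ∀ n, Measurable (h n) := fun n =>
    ((measurable_birkhoffAverage hT₂.measurable hg n).sub_const c).abs
  have hC0 : ∀ x : Ω, 0 ≤ C := fun x => (abs_nonneg _).trans (hC x)
  have hhb : ∀ n x, h n x ≤ C + |c| := by
    intro n x
    refine (abs_sub _ _).trans (add_le_add_left ?_ _)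
    rcases Nat.eq_zero_or_pos n with rfl | hn
    · simpa using hC0 x
    · have := abs_birkhoffAverage_sub_le (T := T₂) (c := 0) hn (f := g) (h := fun _ => C)
        (by simpa using hC) x
      simpa [birkhoffAverage_const hn] using this
  have hbdd : ∀ N x, BddAbove (Set.range fun k => h (N + k) x) := fun N x =>
    ⟨C + |c|, by rintro _ ⟨k, rfl⟩; exact hhb _ _⟩
  set G : ℕ → Ω → ℝ := fun N x => ⨆ k, h (N + k) x with hG
  have hGm : ∀ N, Measurable (G N) := fun N => Measurable.iSup fun k => hhm (N + k)
  have hG0 : ∀ N x, 0 ≤ G N x := fun N x => Real.iSup_nonneg fun k => abs_nonneg _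
  have hGb : ∀ N x, ‖G N x‖ ≤ C + |c| := fun N x => by
    rw [Real.norm_eq_abs, abs_of_nonneg (hG0 N x)]
    exact ciSup_le fun k => hhb _ _
  have hGi : ∀ N, Integrable (G N) μ := fun N =>
    Integrable.of_bound (hGm N).aestronglyMeasurable _ (Eventually.of_forall (hGb N))
  have hGlim : Tendsto (fun N => ∫ x, G N x ∂μ) atTop (𝓝 0) := by
    rw [← integral_zero Ω ℝ (μ := μ)]
    refine tendsto_integral_of_dominated_convergence (fun _ => C + |c|)
      (fun N => (hGm N).aestronglyMeasurable) (integrable_const _)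
      (fun N => Eventually.of_forall (hGb N)) ?_
    filter_upwards [ae_tendsto_birkhoffAverage hT₂ hg hgi] with x hx
    rw [Metric.tendsto_atTop] at hx ⊢
    intro ε hε
    obtain ⟨N, hN⟩ := hx (ε / 2) (half_pos hε)
    refine ⟨N, fun n hn => ?_⟩
    rw [Real.dist_eq, sub_zero, abs_of_nonneg (hG0 n x)]
    refine lt_of_le_of_lt (ciSup_le fun k => ?_) (half_lt_self hε)
    exact (hN (n + k) (by omega)).le
  filter_upwards [ae_all_iff.mpr fun N => ae_tendsto_birkhoffAverage hT₁ (hGm N) (hGi N)] with x hx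
  rw [Metric.tendsto_nhds]
  intro ε hε
  obtain ⟨N, hN⟩ := (hGlim.eventually_lt_const hε).exists
  filter_upwards [(hx N).eventually_lt_const hN, eventually_ge_atTop N, eventually_gt_atTop 0]
    with n hn hnN hn0
  refine lt_of_le_of_lt (abs_birkhoffAverage_sub_le hn0 (fun y => ?_) x) hn
  obtain ⟨k, rfl⟩ := Nat.exists_eq_add_of_le hnN
  exact le_ciSup (hbdd N y) k

end Ergodic

/-! ### Scandictors and their concatenation -/

section Scan

variable {A D : Type*} {B : Finset (ℤ × ℤ)}

lemma length_observed (site : List A → ℤ × ℤ) (x : ℤ × ℤ → A) (t : ℕ) :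
    (observed site x t).length = t := by
  induction t with
  | zero => rfl
  | succ t ih => simp [observed, ih]

lemma take_observed (site : List A → ℤ × ℤ) (x : ℤ × ℤ → A) {s t : ℕ} (hst : s ≤ t) :
    (observed site x t).take s = observed site x s := by
  induction t, hst using Nat.le_induction with
  | base => rw [List.take_of_length_le (length_observed site x s).le]
  | succ t hst ih =>
    rw [observed, List.take_append_of_le_length (by rwa [length_observed]), ih]

namespace Scandictor

lemma visited_mem (S : Scandictor A D B) (x : ℤ × ℤ → A) {t : ℕ} (ht : t < B.card) :
    visited S.site x t ∈ B := by
  have := Finset.mem_image_of_mem (visited S.site x) (Finset.mem_range.mpr ht)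
  rwa [S.covers] at this

lemma observed_congr (S : Scandictor A D B) {x y : ℤ × ℤ → A} (hxy : ∀ i ∈ B, x i = y i) {t : ℕ}
    (ht : t ≤ B.card) : observed S.site x t = observed S.site y t := by
  induction t with
  | zero => rfl
  | succ t ih =>
    have hmem := S.visited_mem x (t := t) (by omega)
    rw [observed, observed, ← ih (by omega)]
    rw [visited] at hmem
    rw [hxy _ hmem]

lemma loss_congr (S : Scandictor A D B) (l : A → D → ℝ) {x y : ℤ × ℤ → A}
    (hxy : ∀ i ∈ B, x i = y i) : S.loss l x = S.loss l y := by
  refine Finset.sum_congr rfl fun t ht => ?_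
  have ht' := Finset.mem_range.mp ht
  have hobs := S.observed_congr hxy ht'.le
  rw [hxy _ (S.visited_mem x ht'), visited, visited, hobs]

/-- The complete list of observations of a scandictor determines the data array on `B`. -/
lemma eqOn_of_observed_eq (S : Scandictor A D B) {x y : ℤ × ℤ → A}
    (hxy : observed S.site x B.card = observed S.site y B.card) : ∀ i ∈ B, x i = y i := by
  intro i hi
  rw [← S.covers x, Finset.mem_image] at hi
  obtain ⟨t, ht, rfl⟩ := hi
  have ht' : t + 1 ≤ B.card := Finset.mem_range.mp ht
  have h0 : observed S.site x t = observed S.site y t := by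
    rw [← take_observed S.site x (t.le_succ.trans ht'), hxy, take_observed _ _ (t.le_succ.trans ht')]
  have h1 : observed S.site x (t + 1) = observed S.site y (t + 1) := by
    rw [← take_observed S.site x ht', hxy, take_observed _ _ ht']
  rw [observed, observed, ← h0] at h1
  have := List.append_cancel_left h1
  simpa [visited] using this

lemma loss_nonneg (S : Scandictor A D B) {l : A → D → ℝ} (hl : ∀ a F, 0 ≤ l a F)
    (x : ℤ × ℤ → A) : 0 ≤ S.loss l x :=
  Finset.sum_nonneg fun _ _ => hl _ _

lemma loss_le (S : Scandictor A D B) {l : A → D → ℝ} {lmax : ℝ} (hl : ∀ a F, l a F ≤ lmax)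
    (x : ℤ × ℤ → A) : S.loss l x ≤ B.card * lmax := by
  refine (Finset.sum_le_card_nsmul _ _ lmax fun _ _ => hl _ _).trans ?_
  simp

lemma normalizedLoss_nonneg (S : Scandictor A D B) {l : A → D → ℝ} (hl : ∀ a F, 0 ≤ l a F)
    (x : ℤ × ℤ → A) : 0 ≤ S.normalizedLoss l x :=
  div_nonneg (S.loss_nonneg hl x) (Nat.cast_nonneg _)

lemma normalizedLoss_le (S : Scandictor A D B) {l : A → D → ℝ} {lmax : ℝ} (h0 : 0 ≤ lmax)
    (hl : ∀ a F, l a F ≤ lmax) (x : ℤ × ℤ → A) : S.normalizedLoss l x ≤ lmax :=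
  div_le_of_le_mul₀ (Nat.cast_nonneg _) h0 (by rw [mul_comm]; exact S.loss_le hl x)

/-- The scandictor that visits the sites of `B` in a fixed order and always makes the same
prediction. -/
noncomputable def fixedOrder (A : Type*) {D : Type*} [Nonempty D] (B : Finset (ℤ × ℤ)) :
    Scandictor A D B where
  site L := B.toList.getD L.length 0
  pred _ := Classical.arbitrary D
  covers x := by
    ext i
    simp only [Finset.mem_image, Finset.mem_range, visited, length_observed]
    rw [← Finset.mem_toList, List.mem_iff_getElem, ← Finset.length_toList]
    constructor
    · rintro ⟨t, ht, rfl⟩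
      exact ⟨t, ht, by rw [List.getD_eq_getElem _ _ ht]⟩
    · rintro ⟨t, ht, rfl⟩
      exact ⟨t, ht, by rw [List.getD_eq_getElem _ _ ht]⟩

instance [Nonempty D] : Nonempty (Scandictor A D B) := ⟨fixedOrder A B⟩

end Scandictor

/-- The data array seen from the site `v`. -/
def shift (v : ℤ × ℤ) (x : ℤ × ℤ → A) : ℤ × ℤ → A := fun j => x (j + v)

lemma observed_translate (site : List A → ℤ × ℤ) (v : ℤ × ℤ) (x : ℤ × ℤ → A) (t : ℕ) :
    observed (fun L => site L + v) x t = observed site (shift v x) t := by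
  induction t with
  | zero => rfl
  | succ t ih => rw [observed, observed, ih, shift]

namespace Scandictor

/-- The scandictor for `B + v` that acts as `S` does on `B`. -/
def translate (S : Scandictor A D B) (v : ℤ × ℤ) :
    Scandictor A D (B.map (addRightEmbedding v)) where
  site L := S.site L + v
  pred := S.pred
  covers x := by
    rw [Finset.card_map, ← Finset.coe_inj, Finset.coe_map]
    conv_rhs => rw [← S.covers (shift v x)]
    rw [Finset.coe_image, Finset.coe_image, Set.image_image]
    refine Set.image_congr fun t _ => ?_
    rw [visited, observed_translate]
    rfl

lemma loss_translate (S : Scandictor A D B) (v : ℤ × ℤ) (l : A → D → ℝ) (x : ℤ × ℤ → A) :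
    (S.translate v).loss l x = S.loss l (shift v x) := by
  simp [loss, translate, visited, observed_translate, shift]

end Scandictor

section Append

variable {B₁ B₂ : Finset (ℤ × ℤ)}

/-- The scanning rule of `S₁` followed by that of `S₂`, where `S₂` is selected by the list of
observations made by `S₁`. -/
def appendSite (S₁ : Scandictor A D B₁) (S₂ : List A → Scandictor A D B₂) (L : List A) : ℤ × ℤ :=
  if L.length < B₁.card then S₁.site L
  else (S₂ (L.take B₁.card)).site (L.drop B₁.card)

variable (S₁ : Scandictor A D B₁) (S₂ : List A → Scandictor A D B₂) (x : ℤ × ℤ → A)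

lemma observed_appendSite_left {t : ℕ} (ht : t ≤ B₁.card) :
    observed (appendSite S₁ S₂) x t = observed S₁.site x t := by
  induction t with
  | zero => rfl
  | succ t ih =>
    rw [observed, observed, ih (by omega), appendSite, if_pos (by rw [length_observed]; omega)]

lemma observed_appendSite_right (t : ℕ) :
    observed (appendSite S₁ S₂) x (B₁.card + t) =
      observed S₁.site x B₁.card ++
        observed (S₂ (observed S₁.site x B₁.card)).site x t := by
  induction t with
  | zero => simp [observed, observed_appendSite_left]
  | succ t ih =>
    rw [← add_assoc, observed, ih, observed, ← List.append_assoc, appendSite,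
      if_neg (by simp [length_observed]), List.take_left' (length_observed _ _ _),
      List.drop_left' (length_observed _ _ _)]

lemma visited_appendSite_left {t : ℕ} (ht : t < B₁.card) :
    visited (appendSite S₁ S₂) x t = visited S₁.site x t := by
  rw [visited, observed_appendSite_left _ _ _ ht.le, appendSite,
    if_pos (by rwa [length_observed]), visited]

lemma visited_appendSite_right (t : ℕ) :
    visited (appendSite S₁ S₂) x (B₁.card + t) =
      visited (S₂ (observed S₁.site x B₁.card)).site x t := by
  rw [visited, observed_appendSite_right, appendSite,
      if_neg (by simp [length_observed]), List.take_left' (length_observed _ _ _),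
      List.drop_left' (length_observed _ _ _), visited]

namespace Scandictor

/-- The concatenation of a scandictor `S₁` for `B₁` and a scandictor for `B₂` that is selected by
the list of observations made by `S₁`. -/
def append (hd : Disjoint B₁ B₂) : Scandictor A D (B₁ ∪ B₂) where
  site := appendSite S₁ S₂
  pred L := if L.length < B₁.card then S₁.pred L
    else (S₂ (L.take B₁.card)).pred (L.drop B₁.card)
  covers x := by
    rw [Finset.card_union_of_disjoint hd, Finset.range_add_eq_union, Finset.image_union,
      Finset.map_eq_image, Finset.image_image]
    congr 1
    · conv_rhs => rw [← S₁.covers x]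
      exact Finset.image_congr fun t ht =>
        visited_appendSite_left S₁ S₂ x (Finset.mem_range.mp ht)
    · conv_rhs => rw [← (S₂ (observed S₁.site x B₁.card)).covers x]
      exact Finset.image_congr fun t _ => visited_appendSite_right S₁ S₂ x t

lemma loss_append (hd : Disjoint B₁ B₂) (l : A → D → ℝ) :
    (append S₁ S₂ hd).loss l x =
      S₁.loss l x + (S₂ (observed S₁.site x B₁.card)).loss l x := by
  rw [loss, Finset.card_union_of_disjoint hd, Finset.sum_range_add]
  congr 1
  · refine Finset.sum_congr rfl fun t ht => ?_
    have ht' := Finset.mem_range.mp ht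
    simp only [append]
    rw [visited_appendSite_left _ _ _ ht', observed_appendSite_left _ _ _ ht'.le,
      if_pos (by rwa [length_observed])]
  · refine Finset.sum_congr rfl fun t _ => ?_
    simp only [append]
    rw [visited_appendSite_right, observed_appendSite_right, if_neg (by simp [length_observed]),
      List.take_left' (length_observed _ _ _), List.drop_left' (length_observed _ _ _)]

lemma isBlockwise_append (hd : Disjoint B₁ B₂) {m : ℕ} (h₁ : S₁.IsBlockwise m)
    (h₂ : ∀ L, (S₂ L).IsBlockwise m)
    (hm : ∀ i ∈ B₁, ∀ j ∈ B₂, blockIndex m i ≠ blockIndex m j) :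
    (append S₁ S₂ hd).IsBlockwise m := by
  intro x s t u hst htu hu
  rw [Finset.card_union_of_disjoint hd] at hu
  simp only [append]
  rcases lt_or_ge u B₁.card with hu₁ | hu₁
  · rw [visited_appendSite_left _ _ _ hu₁, visited_appendSite_left _ _ _ (htu.trans hu₁),
      visited_appendSite_left _ _ _ (hst.trans (htu.trans hu₁))]
    exact h₁ x s t u hst htu hu₁
  · obtain ⟨u, rfl⟩ := Nat.exists_eq_add_of_le hu₁
    rw [visited_appendSite_right]
    rcases lt_or_ge s B₁.card with hs | hs
    · rw [visited_appendSite_left _ _ _ hs]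
      exact fun h => absurd h (hm _ (S₁.visited_mem x hs) _ (visited_mem _ x (by omega)))
    · obtain ⟨s, rfl⟩ := Nat.exists_eq_add_of_le hs
      obtain ⟨t, rfl⟩ := Nat.exists_eq_add_of_le (hs.trans hst.le)
      rw [visited_appendSite_right, visited_appendSite_right]
      exact h₂ _ x s t u (by omega) (by omega) (by omega)

end Scandictor

end Append

/-! ### Block-wise scandictors with adaptively chosen block rules -/

/-- The part of `B` that lies in the cell `c` of the `m × m` grid. -/
def cell (B : Finset (ℤ × ℤ)) (m : ℕ) (c : ℤ × ℤ) : Finset (ℤ × ℤ) :=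
  {i ∈ B | blockIndex m i = c}

lemma Scandictor.isBlockwise_of_forall_mem (S : Scandictor A D B) {m : ℕ} {c : ℤ × ℤ}
    (hc : ∀ i ∈ B, blockIndex m i = c) : S.IsBlockwise m := by
  intro x s t u hst htu hu _
  rw [hc _ (S.visited_mem x (htu.trans hu)), hc _ (S.visited_mem x (hst.trans (htu.trans hu)))]

/-- Scandictors for single cells can be run one after the other. -/
lemma exists_scandictor_of_cells (B : Finset (ℤ × ℤ)) (m : ℕ) (C : Finset (ℤ × ℤ))
    (T : ∀ c, Scandictor A D (cell B m c)) :
    ∃ S : Scandictor A D {i ∈ B | blockIndex m i ∈ C}, S.IsBlockwise m ∧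
      ∀ (l : A → D → ℝ) (x : ℤ × ℤ → A), S.loss l x = ∑ c ∈ C, (T c).loss l x := by
  induction C using Finset.induction_on with
  | empty =>
    have h : {i ∈ B | blockIndex m i ∈ (∅ : Finset (ℤ × ℤ))} = ∅ := by simp
    rw [h]
    refine ⟨⟨(T 0).site, (T 0).pred, fun x => by simp⟩, ?_, fun l x => by simp [Scandictor.loss]⟩
    intro x s t u _ _ hu
    simp at hu
  | insert c C hc ih =>
    obtain ⟨S, hS, hloss⟩ := ih
    have hB : {i ∈ B | blockIndex m i ∈ insert c C} =
        {i ∈ B | blockIndex m i ∈ C} ∪ cell B m c := by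
      ext i
      simp only [cell, Finset.mem_union, Finset.mem_filter, Finset.mem_insert]
      tauto
    have hne : ∀ i ∈ {i ∈ B | blockIndex m i ∈ C}, ∀ j ∈ cell B m c,
        blockIndex m i ≠ blockIndex m j := by
      intro i hi j hj h
      rw [cell, Finset.mem_filter] at hj
      rw [Finset.mem_filter, h, hj.2] at hi
      exact hc hi.2
    have hd : Disjoint {i ∈ B | blockIndex m i ∈ C} (cell B m c) :=
      Finset.disjoint_left.mpr fun i hi hi' => hne i hi i hi' rfl
    rw [hB]
    refine ⟨S.append (fun _ => T c) hd, Scandictor.isBlockwise_append _ _ hd hS (fun _ => ?_) hne,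
      fun l x => ?_⟩
    · exact (T c).isBlockwise_of_forall_mem fun i hi => (Finset.mem_filter.mp hi).2
    · rw [Scandictor.loss_append, hloss, Finset.sum_insert hc, add_comm]

/-- A block-wise scandictor may use the data of the cells in `C₁` to choose, among the rules `T j`,
the one that it applies in the cells of `C₂`. -/
lemma exists_adaptive_scandictor (m : ℕ) {C₁ C₂ : Finset (ℤ × ℤ)} (hC : Disjoint C₁ C₂)
    (hB : ∀ i ∈ B, blockIndex m i ∈ C₁ ∪ C₂) {J : Type*} (T : J → ∀ c, Scandictor A D (cell B m c))
    (j₀ : J) (e : (ℤ × ℤ → A) → J)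
    (he : ∀ x y, (∀ i ∈ B, blockIndex m i ∈ C₁ → x i = y i) → e x = e y) :
    ∃ S : Scandictor A D B, S.IsBlockwise m ∧ ∀ (l : A → D → ℝ) (x : ℤ × ℤ → A),
      S.loss l x = ∑ c ∈ C₁, (T j₀ c).loss l x + ∑ c ∈ C₂, (T (e x) c).loss l x := by
  obtain ⟨S₁, hS₁, hloss₁⟩ := exists_scandictor_of_cells B m C₁ (T j₀)
  choose S₂ hS₂ hloss₂ using fun j => exists_scandictor_of_cells B m C₂ (T j)
  have hB' : B = {i ∈ B | blockIndex m i ∈ C₁} ∪ {i ∈ B | blockIndex m i ∈ C₂} := by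
    rw [← Finset.filter_or, eq_comm, Finset.filter_eq_self]
    exact fun i hi => Finset.mem_union.mp (hB i hi)
  have hne : ∀ i ∈ {i ∈ B | blockIndex m i ∈ C₁}, ∀ j ∈ {i ∈ B | blockIndex m i ∈ C₂},
      blockIndex m i ≠ blockIndex m j := by
    intro i hi j hj h
    rw [Finset.mem_filter] at hi hj
    exact Finset.disjoint_left.mp hC hi.2 (h ▸ hj.2)
  have hd : Disjoint {i ∈ B | blockIndex m i ∈ C₁} {i ∈ B | blockIndex m i ∈ C₂} :=
    Finset.disjoint_left.mpr fun i hi hi' => hne i hi i hi' rfl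
  -- The choice `e x` is recovered from the list of observations made on the cells of `C₁`.
  set obs : (ℤ × ℤ → A) → List A :=
    fun x => observed S₁.site x {i ∈ B | blockIndex m i ∈ C₁}.card with hobs
  have hfac : Function.FactorsThrough e obs := by
    intro x y hxy
    refine he x y fun i hi hi' => S₁.eqOn_of_observed_eq hxy i ?_
    exact Finset.mem_filter.mpr ⟨hi, hi'⟩
  have key : ∃ S : Scandictor A D ({i ∈ B | blockIndex m i ∈ C₁} ∪ {i ∈ B | blockIndex m i ∈ C₂}),
      S.IsBlockwise m ∧ ∀ (l : A → D → ℝ) (x : ℤ × ℤ → A),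
      S.loss l x = ∑ c ∈ C₁, (T j₀ c).loss l x + ∑ c ∈ C₂, (T (e x) c).loss l x := by
    refine ⟨S₁.append (fun L => S₂ (Function.extend obs e (fun _ => j₀) L)) hd,
      Scandictor.isBlockwise_append _ _ hd hS₁ (fun _ => hS₂ _) hne, fun l x => ?_⟩
    rw [Scandictor.loss_append, hloss₁, hloss₂, hfac.extend_apply _ x]
  rwa [← hB'] at key

end Scan

/-! ### A universal scandictor for a finite family of block rules -/

section Universal

variable {A D : Type*}

lemma card_square (n : ℕ) : (square n).card = n ^ 2 := by
  simp [square, sq]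

lemma square_subset_square {k n : ℕ} (h : k ≤ n) : square k ⊆ square n := by
  intro i
  simp only [square, Finset.mem_product, Finset.mem_Ico]
  omega

/-- A cell of the grid that fits into `V_n` is a translate of `V_m`. -/
lemma cell_square {m n : ℕ} (hm : 1 ≤ m) {c : ℤ × ℤ} (hc : c ∈ square (n / m)) :
    cell (square n) m c =
      (square m).map (addRightEmbedding ((m : ℤ) * c.1, (m : ℤ) * c.2)) := by
  have hm' : (0 : ℤ) < m := by exact_mod_cast hm
  have hmn : (m : ℤ) * ((n / m : ℕ) : ℤ) ≤ n := by exact_mod_cast Nat.mul_div_le n m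
  simp only [square, Finset.mem_product, Finset.mem_Ico] at hc
  have key : ∀ d i : ℤ, 0 ≤ d → d < ((n / m : ℕ) : ℤ) →
      (((0 ≤ i ∧ i < n) ∧ i / m = d) ↔ (0 ≤ i - m * d ∧ i - m * d < m)) := by
    intro d i hd0 hd
    have h1 : (m : ℤ) * (d + 1) ≤ n := (mul_le_mul_of_nonneg_left (by omega) hm'.le).trans hmn
    have h2 : 0 ≤ (m : ℤ) * d := mul_nonneg hm'.le hd0
    constructor
    · rintro ⟨-, rfl⟩
      have h3 := Int.emod_add_mul_ediv i m
      have h4 := Int.emod_nonneg i hm'.ne'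
      have h5 := Int.emod_lt_of_pos i hm'
      constructor <;> linarith
    · rintro ⟨h3, h4⟩
      refine ⟨⟨by linarith, by linarith⟩, ?_⟩
      rw [Int.ediv_eq_iff_of_pos hm']
      constructor <;> linarith
  ext ⟨i₁, i₂⟩
  have k1 := key c.1 i₁ hc.1.1 hc.1.2
  have k2 := key c.2 i₂ hc.2.1 hc.2.2
  simp only [cell, square, blockIndex, Finset.mem_filter, Finset.mem_product, Finset.mem_Ico,
    Finset.mem_map, addRightEmbedding_apply, Prod.exists, Prod.ext_iff, Prod.fst_add, Prod.snd_add]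
  constructor
  · rintro ⟨⟨h1, h2⟩, h3, h4⟩
    exact ⟨i₁ - m * c.1, i₂ - m * c.2, ⟨k1.mp ⟨h1, h3⟩, k2.mp ⟨h2, h4⟩⟩, by ring, by ring⟩
  · rintro ⟨a, b, ⟨ha, hb⟩, rfl, rfl⟩
    rw [add_sub_cancel_right] at k1 k2
    obtain ⟨h1, h3⟩ := k1.mpr ha
    obtain ⟨h2, h4⟩ := k2.mpr hb
    exact ⟨⟨h1, h2⟩, h3, h4⟩

/-- The total of `f` over the first `K × K` blocks of side `m` of an array. -/
noncomputable def blockSum (f : (ℤ × ℤ → A) → ℝ) (m K : ℕ) (x : ℤ × ℤ → A) : ℝ :=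
  ∑ c ∈ square K, f (shift ((m : ℤ) * c.1, (m : ℤ) * c.2) x)

/-- A universal block-wise scandictor. Given finitely many rules `E j` for one block, it processes a
training region of `R × R` blocks, with `R² ≤ n / m`, compares the losses that all the rules would
have suffered there, and then applies the rule with the least such loss to all remaining
blocks. Up to the training region and the truncated blocks its loss is the total loss of
that rule. -/
lemma exists_universal_scandictor [Nonempty D] {l : A → D → ℝ} {lmax : ℝ}
    (hl_nonneg : ∀ a F, 0 ≤ l a F) (hl_le : ∀ a F, l a F ≤ lmax) {m : ℕ} (hm : 1 ≤ m)
    {J : Type*} [Finite J] [Nonempty J] (E : J → Scandictor A D (square m)) (n : ℕ) :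
    ∃ S : Scandictor A D (square n), S.IsBlockwise m ∧ ∀ x, ∃ j,
      (∀ j', blockSum ((E j).loss l) m (n / m).sqrt x ≤
        blockSum ((E j').loss l) m (n / m).sqrt x) ∧
      |S.loss l x - blockSum ((E j).loss l) m (n / m) x| ≤
        (((n / m).sqrt ^ 2 * m ^ 2 : ℕ) + ((n ^ 2 : ℕ) - ((n / m) ^ 2 * m ^ 2 : ℕ))) * lmax := by
  set K := n / m with hK
  set R := K.sqrt with hR
  have hRK : square R ⊆ square K := square_subset_square (Nat.sqrt_le_self K)
  set C := (square n).image (blockIndex m) ∪ square K with hC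
  have hKC : square K ⊆ C := Finset.subset_union_right
  have hT : ∀ j c, ∃ T : Scandictor A D (cell (square n) m c), c ∈ square K →
      ∀ x, T.loss l x = (E j).loss l (shift ((m : ℤ) * c.1, (m : ℤ) * c.2) x) := by
    intro j c
    by_cases hc : c ∈ square K
    · rw [cell_square hm hc]
      exact ⟨(E j).translate _, fun _ x => (E j).loss_translate _ l x⟩
    · exact ⟨Scandictor.fixedOrder A _, fun h => absurd h hc⟩
  choose T hT using hT
  have hmin : ∀ v : J → ℝ, ∃ j, ∀ j', v j ≤ v j' := fun v => Finite.exists_min v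
  choose argmin hargmin using hmin
  set e : (ℤ × ℤ → A) → J := fun x => argmin fun j => ∑ c ∈ square R, (T j c).loss l x with he
  have htrain : ∀ j x, ∑ c ∈ square R, (T j c).loss l x = blockSum ((E j).loss l) m R x :=
    fun j x => Finset.sum_congr rfl fun c hc => hT j c (hRK hc) x
  obtain ⟨S, hS, hloss⟩ := exists_adaptive_scandictor (B := square n) m
    (C₁ := square R) (C₂ := C \ square R) Finset.disjoint_sdiff
    (fun i hi => by
      rw [Finset.union_sdiff_of_subset (hRK.trans hKC)]
      exact Finset.mem_union_left _ (Finset.mem_image_of_mem _ hi))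
    T (Classical.arbitrary J) e (fun x y hxy => by
      simp only [he]
      congr 1
      funext j
      refine Finset.sum_congr rfl fun c hc => (T j c).loss_congr l fun i hi => ?_
      rw [cell, Finset.mem_filter] at hi
      exact hxy i hi.1 (hi.2 ▸ hc))
  refine ⟨S, hS, fun x => ⟨e x, fun j' => ?_, ?_⟩⟩
  · rw [← htrain, ← htrain]
    exact hargmin (fun j => ∑ c ∈ square R, (T j c).loss l x) j'
  set t : J → ℤ × ℤ → ℝ := fun j c => (T j c).loss l x with ht
  have ht0 : ∀ j c, 0 ≤ t j c := fun j c => (T j c).loss_nonneg hl_nonneg x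
  have htle : ∀ j c, t j c ≤ (cell (square n) m c).card * lmax := fun j c =>
    (T j c).loss_le hl_le x
  have hcard : ∀ c ∈ square K, (cell (square n) m c).card = m ^ 2 := fun c hc => by
    rw [cell_square hm hc, Finset.card_map, card_square]
  have hcardC : ∑ c ∈ C, (cell (square n) m c).card = n ^ 2 := by
    rw [← card_square n]
    exact (Finset.card_eq_sum_card_fiberwise fun i hi =>
      Finset.mem_union_left _ (Finset.mem_image_of_mem _ hi)).symm
  have hsumK : ∀ k, square k ⊆ square K →
      ∑ c ∈ square k, (cell (square n) m c).card = k ^ 2 * m ^ 2 := fun k hk => by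
    rw [Finset.sum_congr rfl fun c hc => hcard c (hk hc), Finset.sum_const, card_square,
      smul_eq_mul]
  -- the losses on a set of cells are at most `lmax` times the number of its sites
  have hbound : ∀ (C' : Finset (ℤ × ℤ)) j,
      ∑ c ∈ C', t j c ≤ ((∑ c ∈ C', (cell (square n) m c).card : ℕ) : ℝ) * lmax := by
    intro C' j
    rw [Nat.cast_sum, Finset.sum_mul]
    exact Finset.sum_le_sum fun c _ => htle j c
  have hrest : ((∑ c ∈ C \ square K, (cell (square n) m c).card : ℕ) : ℝ) =
      (n ^ 2 : ℕ) - (K ^ 2 * m ^ 2 : ℕ) := by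
    rw [eq_sub_iff_add_eq, ← hsumK K subset_rfl, ← hcardC, ← Nat.cast_add,
      Finset.sum_sdiff hKC]
  have h1 : blockSum ((E (e x)).loss l) m K x = ∑ c ∈ square K, t (e x) c :=
    Finset.sum_congr rfl fun c hc => (hT (e x) c hc x).symm
  have h2 : ∑ c ∈ C \ square R, t (e x) c + ∑ c ∈ square R, t (e x) c =
      ∑ c ∈ C \ square K, t (e x) c + ∑ c ∈ square K, t (e x) c := by
    rw [Finset.sum_sdiff hKC, Finset.sum_sdiff (hRK.trans hKC)]
  have h3 := hbound (square R) (Classical.arbitrary J)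
  have h4 := hbound (square R) (e x)
  have h5 := hbound (C \ square K) (e x)
  rw [hsumK R hRK] at h3 h4
  rw [hrest] at h5
  have p1 : 0 ≤ ∑ c ∈ square R, t (Classical.arbitrary J) c := Finset.sum_nonneg fun c _ => ht0 _ c
  have p2 : 0 ≤ ∑ c ∈ square R, t (e x) c := Finset.sum_nonneg fun c _ => ht0 _ c
  have p3 : 0 ≤ ∑ c ∈ C \ square K, t (e x) c := Finset.sum_nonneg fun c _ => ht0 _ c
  rw [hloss, h1, add_mul, abs_le]
  constructor <;> linarith

/-- The losses of the scandictors for `B` form a bounded, hence totally bounded, family of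
functions on the finite set `A^B`, so finitely many scandictors approximate all of them
uniformly. -/
lemma exists_finite_net [Finite A] [Nonempty D] {B : Finset (ℤ × ℤ)} {l : A → D → ℝ} {lmax : ℝ} (h0 : 0 ≤ lmax)
    (hl_nonneg : ∀ a F, 0 ≤ l a F) (hl_le : ∀ a F, l a F ≤ lmax) {ε : ℝ} (hε : 0 < ε) :
    ∃ (k : ℕ) (E : Fin k → Scandictor A D B), ∀ S : Scandictor A D B, ∃ j, ∀ x,
      (E j).normalizedLoss l x ≤ S.normalizedLoss l x + ε := by
  classical
  rcases isEmpty_or_nonempty A with hA | ⟨⟨a⟩⟩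
  · exact ⟨1, fun _ => Scandictor.fixedOrder A B, fun _ => ⟨0, fun x => (hA.false (x 0)).elim⟩⟩
  have := Fintype.ofFinite (B → A)
  set extend : (B → A) → ℤ × ℤ → A := fun y i => if h : i ∈ B then y ⟨i, h⟩ else a with hextend
  set v : Scandictor A D B → (B → A) → ℝ := fun S y => S.normalizedLoss l (extend y) with hv
  have hvx : ∀ S x, S.normalizedLoss l x = v S (fun i => x i) := by
    intro S x
    simp only [hv, Scandictor.normalizedLoss]
    rw [S.loss_congr l]
    intro i hi
    simp [hextend, hi]
  have hbdd : TotallyBounded (Set.range v) := by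
    refine (isCompact_closedBall (0 : (B → A) → ℝ) lmax).totallyBounded.subset ?_
    rintro _ ⟨S, rfl⟩
    rw [mem_closedBall_zero_iff, pi_norm_le_iff_of_nonneg h0]
    intro y
    rw [Real.norm_eq_abs, abs_of_nonneg (S.normalizedLoss_nonneg hl_nonneg _)]
    exact S.normalizedLoss_le h0 hl_le _
  obtain ⟨t, htv, htf, ht⟩ := totallyBounded_iff_subset.mp hbdd _
    (Metric.dist_mem_uniformity hε)
  have := htf.to_subtype
  obtain ⟨k, ⟨f⟩⟩ := Finite.exists_equiv_fin t
  choose E hE using fun j => htv (f.symm j).2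
  refine ⟨k, E, fun S => ?_⟩
  obtain ⟨w, hw, hSw⟩ := Set.mem_iUnion₂.mp (ht ⟨S, rfl⟩)
  refine ⟨f ⟨w, hw⟩, fun x => ?_⟩
  have hEw : v (E (f ⟨w, hw⟩)) = w := by rw [hE]; simp
  rw [hvx, hvx, hEw]
  have h1 : dist (v S) w < ε := hSw
  have h2 := (dist_le_pi_dist (v S) w fun i => x i).trans_lt h1
  rw [Real.dist_eq, abs_lt] at h2
  linarith

end Universal

/-! ### Ergodicity of the translations of a strongly mixing field -/

section Mixing

variable {A : Type*}

lemma shift_shift (v w : ℤ × ℤ) (x : ℤ × ℤ → A) : shift v (shift w x) = shift (v + w) x := by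
  funext j
  simp [shift, add_assoc]

lemma iterate_shift (v : ℤ × ℤ) (n : ℕ) :
    (shift v)^[n] = shift (A := A) (n • v) := by
  induction n with
  | zero => funext x j; simp [shift]
  | succ n ih =>
    funext x
    rw [Function.iterate_succ_apply', ih, shift_shift, succ_nsmul']

variable [MeasurableSpace A]

lemma measurable_shift (v : ℤ × ℤ) : Measurable (shift (A := A) v) :=
  measurable_pi_lambda _ fun j => measurable_pi_apply (j + v)

variable {Q : Measure (ℤ × ℤ → A)}

lemma IsStationary.measurePreserving_shift (hQ : IsStationary Q) (v : ℤ × ℤ) :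
    MeasurePreserving (shift v) Q Q :=
  ⟨measurable_shift v, hQ v⟩

variable [IsProbabilityMeasure Q]

lemma abs_real_inter_sub_le_one (U V : Set (ℤ × ℤ → A)) :
    |Q.real (U ∩ V) - Q.real U * Q.real V| ≤ 1 := by
  have h1 : 0 ≤ Q.real (U ∩ V) := measureReal_nonneg
  have h2 : Q.real (U ∩ V) ≤ 1 := measureReal_le_one
  have h3 : 0 ≤ Q.real U * Q.real V := mul_nonneg measureReal_nonneg measureReal_nonneg
  have h4 : Q.real U * Q.real V ≤ 1 :=
    mul_le_one₀ measureReal_le_one measureReal_nonneg measureReal_le_one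
  rw [abs_le]
  constructor <;> linarith

lemma abs_real_inter_sub_le_alpha {S T : Set (ℤ × ℤ)} {U V : Set (ℤ × ℤ → A)}
    (hU : MeasurableSet[sigmaOn A S] U) (hV : MeasurableSet[sigmaOn A T] V) :
    |Q.real (U ∩ V) - Q.real U * Q.real V| ≤ alpha Q S T :=
  le_csSup ⟨1, by rintro _ ⟨U, V, -, -, rfl⟩; exact abs_real_inter_sub_le_one U V⟩
    ⟨U, V, hU, hV, rfl⟩

lemma alpha_le_one (S T : Set (ℤ × ℤ)) : alpha Q S T ≤ 1 :=
  Real.sSup_le (by rintro _ ⟨U, V, -, -, rfl⟩; exact abs_real_inter_sub_le_one U V) zero_le_one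

lemma alpha_le_mixingCoeff {S T : Set (ℤ × ℤ)} {k : ℕ}
    (hk : ∀ i ∈ S, ∀ j ∈ T, (k : ℤ) ≤ |i.1 - j.1| + |i.2 - j.2|) :
    alpha Q S T ≤ mixingCoeff Q ⊤ ⊤ k :=
  le_csSup ⟨1, by rintro _ ⟨S, T, -, -, -, rfl⟩; exact alpha_le_one S T⟩
    ⟨S, T, le_top, le_top, hk, rfl⟩

lemma exists_dist_translate_ge (s : Finset (ℤ × ℤ)) {v : ℤ × ℤ} (hv : v ≠ 0) (k : ℕ) :
    ∃ n : ℕ, ∀ i ∈ s, ∀ j ∈ s,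
      (k : ℤ) ≤ |i.1 - (j + n • v).1| + |i.2 - (j + n • v).2| := by
  obtain ⟨M, hM⟩ := Finset.exists_le
    ((s ×ˢ s).image fun p => (|p.1.1 - p.2.1| + |p.1.2 - p.2.2|).toNat)
  refine ⟨k + M, fun i hi j hj => ?_⟩
  have h1 := hM _ (Finset.mem_image_of_mem _ (Finset.mk_mem_product hi hj))
  have hv1 : 1 ≤ |v.1| + |v.2| := by
    by_contra h
    have h1 := abs_nonneg v.1
    have h2 := abs_nonneg v.2
    exact hv (Prod.ext (abs_eq_zero.mp (by omega)) (abs_eq_zero.mp (by omega)))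
  have h2 : ∀ a b c : ℤ, |((k + M : ℕ) : ℤ)| * |c| ≤ |a - (b + (k + M : ℕ) * c)| + |a - b| := by
    intro a b c
    rw [← abs_mul]
    have := abs_sub (a - b) (a - (b + (k + M : ℕ) * c))
    rw [show a - b - (a - (b + (k + M : ℕ) * c)) = (k + M : ℕ) * c by ring] at this
    linarith
  have h3 := h2 i.1 j.1 v.1
  have h4 := h2 i.2 j.2 v.2
  rw [Nat.abs_cast] at h3 h4
  have h5 : ((k + M : ℕ) : ℤ) ≤ (k + M : ℕ) * (|v.1| + |v.2|) :=
    le_mul_of_one_le_right (Nat.cast_nonneg _) hv1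
  rw [mul_add] at h5
  simp only [Prod.fst_add, Prod.snd_add, Prod.smul_fst, Prod.smul_snd]
  simp only [nsmul_eq_mul]
  push_cast at *
  omega

/-- A measurable cylinder becomes asymptotically independent of its translates. -/
lemma exists_abs_real_cylinder_inter_le (hQ : IsStationary Q) (hmix : IsStronglyMixing Q)
    {v : ℤ × ℤ} (hv : v ≠ 0) {C : Set (ℤ × ℤ → A)} (hC : C ∈ measurableCylinders fun _ => A)
    {ε : ℝ} (hε : 0 < ε) :
    ∃ n : ℕ, |Q.real (C ∩ shift (n • v) ⁻¹' C) - Q.real C * Q.real C| < ε := by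
  obtain ⟨s, U, hU, rfl⟩ := (mem_measurableCylinders _).mp hC
  obtain ⟨k, hk⟩ := ((hmix ⊤ ⊤).eventually_lt_const hε).exists
  obtain ⟨n, hn⟩ := exists_dist_translate_ge s hv k
  refine ⟨n, lt_of_le_of_lt ?_ hk⟩
  have hpres : Q.real (shift (n • v) ⁻¹' cylinder s U) = Q.real (cylinder s U) :=
    (hQ.measurePreserving_shift _).measureReal_preimage
      (MeasurableSet.cylinder s hU).nullMeasurableSet
  have h1 : MeasurableSet[sigmaOn A (s : Set (ℤ × ℤ))] (cylinder s U) := ⟨U, hU, rfl⟩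
  have h2 : MeasurableSet[sigmaOn A ((fun j => j + n • v) '' (s : Set (ℤ × ℤ)))]
      (shift (n • v) ⁻¹' cylinder s U) := by
    refine ⟨(fun y (i : s) => y ⟨i + n • v, Set.mem_image_of_mem _ i.2⟩) ⁻¹' U, ?_, rfl⟩
    exact measurableSet_preimage (measurable_pi_lambda _ fun i => measurable_pi_apply _) hU
  have h3 := abs_real_inter_sub_le_alpha (Q := Q) h1 h2
  rw [hpres] at h3
  refine h3.trans (alpha_le_mixingCoeff ?_)
  rintro i hi _ ⟨j, hj, rfl⟩
  exact hn i hi j hj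

/-- Every nontrivial translation is ergodic under a strongly mixing stationary law: an invariant
event is approximated by a cylinder, which is almost independent of a distant translate, so that the
event is independent of itself. -/
lemma IsStronglyMixing.ergodic_shift (hmix : IsStronglyMixing Q) (hQ : IsStationary Q)
    {v : ℤ × ℤ} (hv : v ≠ 0) : Ergodic (shift v) Q := by
  refine ⟨hQ.measurePreserving_shift v, ⟨fun s hs hinv => ?_⟩⟩
  have hsq : Q.real s = Q.real s * Q.real s := by
    by_contra hne
    set ε := |Q.real s - Q.real s * Q.real s| / 5 with hε
    have hε0 : 0 < ε := div_pos (abs_pos.mpr (sub_ne_zero.mpr hne)) (by norm_num)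
    obtain ⟨C, hC, hCs⟩ := exists_measure_symmDiff_lt_of_generateFrom_isSetRing (μ := Q)
      (isSetRing_measurableCylinders (α := fun _ : ℤ × ℤ => A))
      ⟨{Set.univ}, Set.countable_singleton _, 
        Set.singleton_subset_iff.mpr (univ_mem_measurableCylinders _), by simp⟩
      generateFrom_measurableCylinders.symm hs (ENNReal.ofReal_pos.mpr hε0)
    have hCm := MeasurableSet.of_mem_measurableCylinders hC
    have hd : Q.real (symmDiff C s) < ε := by
      rw [measureReal_def]
      exact (ENNReal.lt_ofReal_iff_toReal_lt (measure_ne_top _ _)).mp hCs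
    obtain ⟨n, hn⟩ := exists_abs_real_cylinder_inter_le hQ hmix hv hC hε0
    have hinv' : shift (n • v) ⁻¹' s = s := by
      rw [← iterate_shift]
      rw [Set.preimage_iterate_eq]
      exact Function.iterate_fixed hinv n
    have hd' : Q.real (symmDiff (shift (n • v) ⁻¹' C) s) < ε := by
      conv_lhs => rw [← hinv', ← Set.preimage_symmDiff]
      rwa [(hQ.measurePreserving_shift _).measureReal_preimage (hCm.symmDiff hs).nullMeasurableSet]
    have h1 := abs_measureReal_sub_le_measureReal_symmDiff (μ := Q) hCm.nullMeasurableSet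
      hs.nullMeasurableSet
    have h2 : |Q.real (C ∩ shift (n • v) ⁻¹' C) - Q.real s| < 2 * ε := by
      refine (abs_measureReal_sub_le_measureReal_symmDiff
        (hCm.inter (measurable_shift _ hCm)).nullMeasurableSet hs.nullMeasurableSet).trans_lt ?_
      have hsub : symmDiff (C ∩ shift (n • v) ⁻¹' C) s ⊆
          symmDiff C s ∪ symmDiff (shift (n • v) ⁻¹' C) s := by
        intro x
        simp only [Set.mem_symmDiff, Set.mem_inter_iff, Set.mem_union]
        tauto
      have := (measureReal_mono hsub (μ := Q)).trans (measureReal_union_le _ _)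
      linarith
    have h3 : |Q.real C * Q.real C - Q.real s * Q.real s| < 2 * ε := by
      rw [show Q.real C * Q.real C - Q.real s * Q.real s =
        (Q.real C + Q.real s) * (Q.real C - Q.real s) by ring, abs_mul,
        abs_of_nonneg (add_nonneg measureReal_nonneg measureReal_nonneg)]
      have h5 : Q.real C ≤ 1 := measureReal_le_one
      have h6 : Q.real s ≤ 1 := measureReal_le_one
      calc (Q.real C + Q.real s) * |Q.real C - Q.real s| ≤ 2 * |Q.real C - Q.real s| :=
            mul_le_mul_of_nonneg_right (by linarith) (abs_nonneg _)
        _ < 2 * ε := by linarith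
    have h4 : |Q.real s - Q.real s * Q.real s| < 5 * ε := by
      rw [abs_lt] at hn h2 h3 ⊢
      constructor <;> linarith
    rw [hε] at h4
    linarith
  rw [eventuallyConst_set']
  have h01 : Q.real s = 0 ∨ Q.real s = 1 := by
    rcases eq_or_ne (Q.real s) 0 with h | h
    · exact Or.inl h
    · exact Or.inr (mul_left_cancel₀ h (by rw [mul_one]; exact hsq.symm))
  rcases h01 with h | h
  · left
    rwa [measureReal_eq_zero_iff, ← ae_eq_empty] at h
  · right
    rw [ae_eq_univ, prob_compl_eq_zero_iff hs, ← ENNReal.toReal_eq_one_iff]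
    exact h

end Mixing

/-! ### Almost sure convergence and the limit of the scandictabilities -/

section Convergence

/-- Explore, then commit: if `j n` minimizes the values `a · (R n)` of an initial stage, then the values
`a (j n) (K n)` of a later stage converge to the least of the limits. -/
lemma tendsto_explore_commit {J : Type*} [Finite J] {a : J → ℕ → ℝ} {μ : J → ℝ}
    (ha : ∀ j, Tendsto (a j) atTop (𝓝 (μ j))) {j₀ : J} (hj₀ : ∀ j, μ j₀ ≤ μ j) {R K : ℕ → ℕ}
    (hR : Tendsto R atTop atTop) (hK : Tendsto K atTop atTop) {j : ℕ → J}
    (hj : ∀ n j', a (j n) (R n) ≤ a j' (R n)) :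
    Tendsto (fun n => a (j n) (K n)) atTop (𝓝 (μ j₀)) := by
  rw [Metric.tendsto_nhds]
  intro ε hε
  have hev : ∀ᶠ n in atTop, ∀ i, |a i n - μ i| < ε / 3 := by
    rw [eventually_all]
    intro i
    have := (Metric.tendsto_nhds.mp (ha i)) (ε / 3) (by linarith)
    simpa only [Real.dist_eq] using this
  filter_upwards [hR.eventually hev, hK.eventually hev] with n h1 h2
  have h3 := abs_lt.mp (h1 (j n))
  have h4 := abs_lt.mp (h1 j₀)
  have h5 := abs_lt.mp (h2 (j n))
  have h6 := hj n j₀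
  have h7 := hj₀ (j n)
  rw [Real.dist_eq, abs_lt]
  constructor <;> linarith

lemma tendsto_natDiv_div {m : ℕ} (hm : 1 ≤ m) :
    Tendsto (fun n : ℕ => ((n / m : ℕ) : ℝ) / n) atTop (𝓝 (1 / m)) := by
  have hm' : (0 : ℝ) < m := by exact_mod_cast hm
  rw [tendsto_iff_dist_tendsto_zero]
  refine squeeze_zero' (Eventually.of_forall fun _ => dist_nonneg) ?_
    tendsto_one_div_atTop_nhds_zero_nat
  filter_upwards [eventually_gt_atTop 0] with n hn
  have hn' : (0 : ℝ) < n := by exact_mod_cast hn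
  have h1 : (m : ℝ) * (n / m : ℕ) ≤ n := by exact_mod_cast Nat.mul_div_le n m
  have h2 : (n : ℝ) < m * ((n / m : ℕ) + 1) := by
    exact_mod_cast Nat.lt_mul_div_succ n hm
  rw [Real.dist_eq, div_sub_div _ _ hn'.ne' hm'.ne', abs_div, abs_of_pos (mul_pos hn' hm'),
    div_le_div_iff₀ (mul_pos hn' hm') hn', one_mul, mul_comm]
  refine mul_le_mul_of_nonneg_left ?_ hn'.le
  rw [abs_le]
  constructor <;> linarith

/-- The share of the training region and of the truncated blocks in `V_n` vanishes. -/
lemma tendsto_overhead {m : ℕ} (hm : 1 ≤ m) :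
    Tendsto (fun n : ℕ => ((((n / m).sqrt ^ 2 * m ^ 2 : ℕ) : ℝ) +
      ((n ^ 2 : ℕ) - ((n / m) ^ 2 * m ^ 2 : ℕ))) / (n : ℝ) ^ 2) atTop (𝓝 0) := by
  have hm' : (m : ℝ) ≠ 0 := by positivity
  have h1 := tendsto_natDiv_div hm
  have h2 : Tendsto (fun n : ℕ => (((n / m).sqrt ^ 2 : ℕ) : ℝ) / (n : ℝ) ^ 2) atTop (𝓝 0) := by
    have h3 : Tendsto (fun n : ℕ => ((n / m : ℕ) : ℝ) / n * (1 / n)) atTop (𝓝 (1 / m * 0)) :=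
      h1.mul tendsto_one_div_atTop_nhds_zero_nat
    rw [mul_zero] at h3
    refine squeeze_zero (fun n => by positivity) (fun n => ?_) h3
    rw [div_mul_div_comm, mul_one, ← sq]
    gcongr
    exact Nat.sqrt_le' _
  have h4 := (h2.mul_const ((m : ℝ) ^ 2)).add
    ((tendsto_const_nhds (x := (1 : ℝ))).sub ((h1.pow 2).mul_const ((m : ℝ) ^ 2)))
  rw [show (0 : ℝ) * (m : ℝ) ^ 2 + (1 - (1 / (m : ℝ)) ^ 2 * (m : ℝ) ^ 2) = 0 by field_simp; ring]
    at h4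
  refine h4.congr' ?_
  filter_upwards [eventually_gt_atTop 0] with n hn
  have hn' : (n : ℝ) ≠ 0 := by positivity
  push_cast
  field_simp

variable {A D : Type*}

lemma squareAverage_shift (f : (ℤ × ℤ → A) → ℝ) (m K : ℕ) (x : ℤ × ℤ → A) :
    squareAverage (shift ((m : ℤ), 0)) (shift (0, (m : ℤ))) f K x =
      blockSum f m K x / (K : ℝ) ^ 2 := by
  have hIco : Finset.Ico (0 : ℤ) K = (Finset.range K).map Nat.castEmbedding := by
    ext i
    simp only [Finset.mem_Ico, Finset.mem_map, Finset.mem_range, Nat.castEmbedding_apply]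
    constructor
    · rintro ⟨h0, h1⟩
      exact ⟨i.toNat, by omega, by omega⟩
    · rintro ⟨k, hk, rfl⟩
      omega
  simp only [squareAverage, birkhoffAverage, birkhoffSum, iterate_shift, shift_shift, blockSum,
    square, Finset.sum_product, hIco, Finset.sum_map, smul_eq_mul, ← Finset.mul_sum,
    Nat.castEmbedding_apply]
  rw [← mul_assoc, ← mul_inv, ← sq, div_eq_inv_mul]
  congr 1
  refine Finset.sum_congr rfl fun i _ => Finset.sum_congr rfl fun j _ => ?_
  congr 2
  ext <;> simp [mul_comm]

lemma scandictabilityOn_le [MeasurableSpace A] {Q : Measure (ℤ × ℤ → A)} {l : A → D → ℝ}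
    (hl_nonneg : ∀ a F, 0 ≤ l a F) {B : Finset (ℤ × ℤ)}
    (S : Scandictor A D B) : scandictabilityOn l Q B ≤ ∫ x, S.normalizedLoss l x ∂Q :=
  ciInf_le ⟨0, by
    rintro _ ⟨S, rfl⟩
    exact integral_nonneg fun x => S.normalizedLoss_nonneg hl_nonneg x⟩ S

variable [Finite A] [MeasurableSpace A] [DiscreteMeasurableSpace A]

lemma Scandictor.measurable_loss {B : Finset (ℤ × ℤ)} (S : Scandictor A D B) (l : A → D → ℝ) :
    Measurable (S.loss l) := by
  set r : (ℤ × ℤ → A) → B → A := fun x i => x i with hr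
  have hfac : Function.FactorsThrough (S.loss l) r := fun x y hxy =>
    S.loss_congr l fun i hi => congrFun hxy ⟨i, hi⟩
  have h : S.loss l = Function.extend r (S.loss l) 0 ∘ r :=
    funext fun x => (hfac.extend_apply 0 x).symm
  rw [h]
  exact Measurable.of_discrete.comp (measurable_pi_lambda _ fun i => measurable_pi_apply _)

lemma Scandictor.measurable_normalizedLoss {B : Finset (ℤ × ℤ)} (S : Scandictor A D B)
    (l : A → D → ℝ) : Measurable (S.normalizedLoss l) :=
  (S.measurable_loss l).div_const _

variable {Q : Measure (ℤ × ℤ → A)} [IsProbabilityMeasure Q] {l : A → D → ℝ} {lmax : ℝ}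

lemma Scandictor.integrable_normalizedLoss (h0 : 0 ≤ lmax) (hl_nonneg : ∀ a F, 0 ≤ l a F)
    (hl_le : ∀ a F, l a F ≤ lmax) {B : Finset (ℤ × ℤ)} (S : Scandictor A D B) :
    Integrable (S.normalizedLoss l) Q := by
  refine Integrable.of_bound (S.measurable_normalizedLoss l).aestronglyMeasurable lmax
    (Eventually.of_forall fun x => ?_)
  rw [Real.norm_eq_abs, abs_of_nonneg (S.normalizedLoss_nonneg hl_nonneg x)]
  exact S.normalizedLoss_le h0 hl_le x

/-- The average loss of a fixed block rule over growing squares of blocks converges to its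
expectation. -/
lemma ae_tendsto_blockSum_loss (hQ : IsStationary Q) (hmix : IsStronglyMixing Q)
    (hl_nonneg : ∀ a F, 0 ≤ l a F) (hl_le : ∀ a F, l a F ≤ lmax) {m : ℕ} (hm : 1 ≤ m)
    {B : Finset (ℤ × ℤ)} (S : Scandictor A D B) :
    ∀ᵐ x ∂Q, Tendsto (fun K : ℕ => blockSum (S.loss l) m K x / (K : ℝ) ^ 2) atTop
      (𝓝 (∫ x, S.loss l x ∂Q)) := by
  have hm' : (m : ℤ) ≠ 0 := by exact_mod_cast (by omega : m ≠ 0)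
  have := ae_tendsto_squareAverage
    (hmix.ergodic_shift hQ (v := ((m : ℤ), 0)) (by simpa using hm'))
    (hmix.ergodic_shift hQ (v := (0, (m : ℤ))) (by simpa using hm'))
    (S.measurable_loss l) (C := B.card * lmax) (fun x => by
      rw [abs_of_nonneg (S.loss_nonneg hl_nonneg x)]
      exact S.loss_le hl_le x)
  simpa only [squareAverage_shift] using this

/-- For every block size there are universal block-wise scandictors whose normalized losses converge
almost surely to a constant that exceeds the scandictability on one block by at most `1 / m`. -/
lemma exists_universal_sequence [Nonempty D] (l : A → D → ℝ) (h0 : 0 ≤ lmax)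
    (hl_nonneg : ∀ a F, 0 ≤ l a F) (hl_le : ∀ a F, l a F ≤ lmax) {m : ℕ} (hm : 1 ≤ m) :
    ∃ S : (n : ℕ) → Scandictor A D (square n), (∀ n, (S n).IsBlockwise m) ∧
      ∀ Q : Measure (ℤ × ℤ → A), IsProbabilityMeasure Q → IsStationary Q → IsStronglyMixing Q →
        ∃ e : ℝ, scandictabilityOn l Q (square m) ≤ e ∧
          e ≤ scandictabilityOn l Q (square m) + 1 / m ∧
          ∀ᵐ x ∂Q, Tendsto (fun n => (S n).normalizedLoss l x) atTop (𝓝 e) := by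
  have hm' : (0 : ℝ) < m := by exact_mod_cast hm
  obtain ⟨k, E, hE⟩ := exists_finite_net (B := square m) h0 hl_nonneg hl_le (ε := 1 / (m : ℝ))
    (by positivity)
  obtain ⟨j₁, -⟩ := hE (Scandictor.fixedOrder A _)
  have : Nonempty (Fin k) := ⟨j₁⟩
  choose S hS hloss using exists_universal_scandictor hl_nonneg hl_le hm E
  refine ⟨S, hS, fun Q _ hQ hmix => ?_⟩
  obtain ⟨j₀, hj₀⟩ := Finite.exists_min fun j => ∫ x, (E j).loss l x ∂Q
  have hint : ∀ j, ∫ x, (E j).normalizedLoss l x ∂Q = (∫ x, (E j).loss l x ∂Q) / (m : ℝ) ^ 2 := by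
    intro j
    simp only [Scandictor.normalizedLoss]
    rw [integral_div, card_square, Nat.cast_pow]
  refine ⟨∫ x, (E j₀).normalizedLoss l x ∂Q, scandictabilityOn_le hl_nonneg _, ?_, ?_⟩
  · rw [← sub_le_iff_le_add]
    refine le_ciInf fun S' => ?_
    obtain ⟨j, hj⟩ := hE S'
    have h1 : ∫ x, (E j₀).normalizedLoss l x ∂Q ≤ ∫ x, (E j).normalizedLoss l x ∂Q := by
      rw [hint, hint]
      exact div_le_div_of_nonneg_right (hj₀ j) (by positivity)
    have hS'i := S'.integrable_normalizedLoss (Q := Q) h0 hl_nonneg hl_le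
    have h2 : ∫ x, (E j).normalizedLoss l x ∂Q ≤ ∫ x, (S'.normalizedLoss l x + 1 / m) ∂Q :=
      integral_mono ((E j).integrable_normalizedLoss h0 hl_nonneg hl_le)
        (hS'i.add (integrable_const _)) hj
    rw [integral_add hS'i (integrable_const _)] at h2
    simp only [integral_const, probReal_univ, one_smul] at h2
    linarith
  · filter_upwards [ae_all_iff.mpr fun j =>
      ae_tendsto_blockSum_loss hQ hmix hl_nonneg hl_le hm (E j)] with x hx
    have hK : Tendsto (fun n => n / m) atTop atTop := Nat.tendsto_div_const_atTop (by omega)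
    have hR : Tendsto (fun n => (n / m).sqrt) atTop atTop := by
      refine (tendsto_atTop_atTop.mpr fun b => ⟨b * b, fun a ha => ?_⟩ :
        Tendsto Nat.sqrt atTop atTop).comp hK
      exact Nat.le_sqrt.mpr ha
    choose j hjmin hjloss using fun n => hloss n x
    have h1 := tendsto_explore_commit hx hj₀ hR hK (j := j)
      (fun n j' => div_le_div_of_nonneg_right (hjmin n j') (by positivity))
    have h2 := h1.mul ((tendsto_natDiv_div hm).pow 2)
    have h3 := (tendsto_overhead hm).mul_const lmax
    rw [zero_mul] at h3
    rw [hint, div_eq_mul_one_div, ← one_div_pow]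
    have h4 : Tendsto (fun n => (S n).normalizedLoss l x -
        blockSum ((E (j n)).loss l) m (n / m) x / ((n / m : ℕ) : ℝ) ^ 2 *
          (((n / m : ℕ) : ℝ) / n) ^ 2) atTop (𝓝 0) := by
      refine squeeze_zero_norm' ?_ h3
      filter_upwards [hK.eventually_gt_atTop 0, eventually_gt_atTop 0] with n hKn hn
      have hKn' : ((n / m : ℕ) : ℝ) ≠ 0 := by exact_mod_cast hKn.ne'
      have hn' : (0 : ℝ) < n := by exact_mod_cast hn
      rw [Scandictor.normalizedLoss, card_square, Nat.cast_pow, div_pow, div_mul_div_cancel₀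
        (pow_ne_zero 2 hKn'), ← sub_div, Real.norm_eq_abs, abs_div, abs_of_pos (pow_pos hn' 2),
        div_mul_eq_mul_div]
      refine div_le_div_of_nonneg_right ?_ (by positivity)
      simpa only [Nat.cast_pow] using hjloss n
    simpa using h4.add h2

end Convergence

end Scandiction

theorem corollary1 {A D : Type*} [Finite A] [MeasurableSpace A] [DiscreteMeasurableSpace A]
    [Nonempty D] [PseudoMetricSpace D]
    (l : A → D → ℝ) (lmax : ℝ) (hl_nonneg : ∀ a F, 0 ≤ l a F) (hl_le : ∀ a F, l a F ≤ lmax)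
    (hD : Finite D ∨
      (Bornology.IsBounded (Set.univ : Set D) ∧ ∃ c : NNReal, ∀ a, LipschitzWith c (l a))) :
    ∃ S : ℕ → (n : ℕ) → Scandiction.Scandictor A D (Scandiction.square n),
      (∀ m : ℕ, 1 ≤ m → ∀ n : ℕ, (S m n).IsBlockwise m) ∧
      ∀ Q : MeasureTheory.Measure (ℤ × ℤ → A), MeasureTheory.IsProbabilityMeasure Q →
        Scandiction.IsStationary Q → Scandiction.IsStronglyMixing Q →
          Filter.Tendsto
            (fun n : ℕ => Scandiction.scandictabilityOn l Q (Scandiction.square n))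
            Filter.atTop (nhds (Scandiction.scandictability l Q)) ∧
          (∃ δ : ℕ → ℝ, Filter.Tendsto δ Filter.atTop (nhds 0) ∧
            ∀ m : ℕ, 1 ≤ m → ∀ᵐ x ∂Q,
              Filter.liminf (fun n : ℕ => (S m n).normalizedLoss l x) Filter.atTop
                ≤ Scandiction.scandictability l Q + δ m) ∧
          ∀ᵐ x ∂Q, Filter.Tendsto
            (fun m : ℕ =>
              Filter.liminf (fun n : ℕ => (S m n).normalizedLoss l x) Filter.atTop)
            Filter.atTop (nhds (Scandiction.scandictability l Q)) := by
  open Filter Topology MeasureTheory Scandiction in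
  -- `lmax` may be negative when `A` is empty.
  have h0 : (0 : ℝ) ≤ max lmax 0 := le_max_right _ _
  have hl_le' : ∀ a F, l a F ≤ max lmax 0 := fun a F => (hl_le a F).trans (le_max_left _ _)
  have hex : ∀ m : ℕ, ∃ S : (n : ℕ) → Scandictor A D (square n), 1 ≤ m →
      (∀ n, (S n).IsBlockwise m) ∧
      ∀ Q : Measure (ℤ × ℤ → A), IsProbabilityMeasure Q → IsStationary Q → IsStronglyMixing Q →
        ∃ e : ℝ, scandictabilityOn l Q (square m) ≤ e ∧
          e ≤ scandictabilityOn l Q (square m) + 1 / m ∧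
          ∀ᵐ x ∂Q, Tendsto (fun n => (S n).normalizedLoss l x) atTop (𝓝 e) := by
    intro m
    by_cases hm : 1 ≤ m
    · obtain ⟨S, hS⟩ := exists_universal_sequence l h0 hl_nonneg hl_le' hm
      exact ⟨S, fun _ => hS⟩
    · exact ⟨fun n => Scandictor.fixedOrder A _, fun h => absurd h hm⟩
  choose S hS using hex
  refine ⟨S, fun m hm => (hS m hm).1, fun Q hP hQ hmix => ?_⟩
  set u : ℕ → ℝ := fun n => scandictabilityOn l Q (square n) with hu
  have he : ∀ m, ∃ e : ℝ, 1 ≤ m → u m ≤ e ∧ e ≤ u m + 1 / m ∧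
      ∀ᵐ x ∂Q, Tendsto (fun n => (S m n).normalizedLoss l x) atTop (𝓝 e) := by
    intro m
    by_cases hm : 1 ≤ m
    · obtain ⟨e, h⟩ := (hS m hm).2 Q hP hQ hmix
      exact ⟨e, fun _ => h⟩
    · exact ⟨0, fun h => absurd h hm⟩
  choose e he using he
  have hu0 : ∀ n, 0 ≤ u n := fun n => Real.iInf_nonneg fun S' =>
    integral_nonneg fun x => S'.normalizedLoss_nonneg hl_nonneg x
  have hule : ∀ n, u n ≤ max lmax 0 := fun n => by
    refine (scandictabilityOn_le hl_nonneg (Scandictor.fixedOrder A (square n))).trans ?_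
    refine (integral_mono (Scandictor.integrable_normalizedLoss h0 hl_nonneg hl_le' _)
      (integrable_const (max lmax 0)) fun x =>
        Scandictor.normalizedLoss_le _ h0 hl_le' x).trans_eq ?_
    simp
  have hbdd_le : IsBoundedUnder (· ≤ ·) atTop u := isBoundedUnder_of ⟨_, hule⟩
  have hbdd_ge : IsBoundedUnder (· ≥ ·) atTop u := isBoundedUnder_of ⟨0, hu0⟩
  -- The scandictors for block size `m` show that `limsup u ≤ e m`, by dominated convergence.
  have hlimsup : ∀ m, 1 ≤ m → limsup u atTop ≤ e m := by
    intro m hm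
    have hlim : Tendsto (fun n => ∫ x, (S m n).normalizedLoss l x ∂Q) atTop (𝓝 (e m)) := by
      have := tendsto_integral_of_dominated_convergence (μ := Q) (fun _ => max lmax 0)
        (F := fun n x => (S m n).normalizedLoss l x) (f := fun _ => e m)
        (fun n => ((S m n).measurable_normalizedLoss l).aestronglyMeasurable) (integrable_const _)
        (fun n => Eventually.of_forall fun x => by
          rw [Real.norm_eq_abs, abs_of_nonneg ((S m n).normalizedLoss_nonneg hl_nonneg x)]
          exact (S m n).normalizedLoss_le h0 hl_le' x)
        (he m hm).2.2
      simpa using this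
    rw [← hlim.limsup_eq]
    exact limsup_le_limsup (Eventually.of_forall fun n => scandictabilityOn_le hl_nonneg (S m n))
      hbdd_ge.isCoboundedUnder_le hlim.isBoundedUnder_le
  have hconv : Tendsto u atTop (𝓝 (limsup u atTop)) := by
    refine tendsto_of_le_liminf_of_limsup_le ?_ le_rfl hbdd_le hbdd_ge
    refine le_of_forall_pos_le_add fun ε hε => ?_
    rw [← sub_le_iff_le_add]
    refine le_liminf_of_le hbdd_le.isCoboundedUnder_ge ?_
    filter_upwards [tendsto_one_div_atTop_nhds_zero_nat.eventually_lt_const hε,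
      eventually_ge_atTop 1] with m h1 hm
    linarith [hlimsup m hm, (he m hm).2.1]
  have hU : scandictability l Q = limsup u atTop := hconv.limUnder_eq
  rw [← hU] at hconv
  have hlim_e : Tendsto e atTop (𝓝 (scandictability l Q)) := by
    have h2 : Tendsto (fun m : ℕ => u m + 1 / (m : ℝ)) atTop (𝓝 (scandictability l Q + 0)) :=
      hconv.add tendsto_one_div_atTop_nhds_zero_nat
    rw [add_zero] at h2
    refine tendsto_of_tendsto_of_tendsto_of_le_of_le' hconv h2 ?_ ?_
    · filter_upwards [eventually_ge_atTop 1] with m hm using (he m hm).1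
    · filter_upwards [eventually_ge_atTop 1] with m hm using (he m hm).2.1
  refine ⟨hconv, ⟨fun m => e m - scandictability l Q, ?_, fun m hm => ?_⟩, ?_⟩
  · simpa using hlim_e.sub_const (scandictability l Q)
  · filter_upwards [(he m hm).2.2] with x hx
    rw [hx.liminf_eq]
    linarith
  · have hae : ∀ᵐ x ∂Q, ∀ m, 1 ≤ m →
        Tendsto (fun n => (S m n).normalizedLoss l x) atTop (𝓝 (e m)) := by
      rw [ae_all_iff]
      intro m
      by_cases hm : 1 ≤ m
      · filter_upwards [(he m hm).2.2] with x hx using fun _ => hx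
      · exact Eventually.of_forall fun x h => absurd h hm
    filter_upwards [hae] with x hx
    refine hlim_e.congr' ?_
    filter_upwards [eventually_ge_atTop 1] with m hm using (hx m hm).liminf_eq.symm
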